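/- For $G\subseteq \mathrm{O}(n)$, a (smooth) $n$-dimensional Riemannian manifold $X$ is called a $G$-manifold if for every $x\in X$ there is an isometric identification $\mathbb R^n\cong T_xX$ under which the holonomy group at $x$ (the group of parallel transports of the Levi-Civita connection around piecewise smooth loops at $x$) is contained in $G$. Identify $\mathbb R^{10}$ with $\mathbb C^5$, so that $\mathrm{SU}(5)\subset \mathrm{O}(10)$, and let $$\mathcal G=\mathrm S(\mathrm U(3)\times \mathrm U(2))=\left\{x\in \mathrm{SU}(5): x=\begin{pmatrix} g&0\\0&h\end{pmatrix},\ g\in \mathrm U(3),\ h\in \mathrm U(2)\right\}\subset \mathrm{SU}(5)\subset \mathrm O(10).$$ A 10-dimensional Calabi–Yau manifold is a 10-dimensional Riemannian manifold $X$ with orthogonal complex structures $J_x\colon T_xX\to T_xX$ ($x\in X$) preserved by parallel transport, such that for every $x$ the holonomy group at $x$ is contained in $\mathrm{SU}(5)$ under some isometric identification $\mathbb C^5\cong T_xX$ that carries multiplication by $i$ to $J_x$. **Proposition.** A 10-dimensional Riemannian manifold $X$ is a $\mathcal G$-manifold if and only if it admits a structure $J$ of Calabi–Yau manifold together with a splitting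 $T_xX=V_x\oplus W_x$ of each tangent space into orthogonal subspaces with $\dim_{\mathbb R}V_x=4$ and $\dim_{\mathbb R}W_x=6$, such that $J_xV_x\subseteq V_x$ and $J_xW_x\subseteq W_x$ for all $x$, and every parallel transport $T_xX\to T_yX$ along a piecewise smooth curve maps $V_x$ into $V_y$ and $W_x$ into $W_y$. Moreover, $\mathbb C^2=\{z_1=z_2=z_3=0\}$ and $\mathbb C^3=\{z_4=z_5=0\}$ are orthogonal complementary complex subspaces of $\mathbb C^5$, of dimensions 2 and 3, and $\mathcal G$ is exactly the subgroup of those elements of $\mathrm{SU}(5)$ that map each of these two subspaces into itself. -/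

import Mathlib

open Bundle Set
open scoped Manifold ContDiff Topology

noncomputable section

/-! ### Riemannian geometry: the Levi-Civita connection in charts, parallel transport, holonomy -/

/-- `ℝⁿ` with its Euclidean inner product. -/
abbrev RSpace (n : ℕ) : Type := EuclideanSpace ℝ (Fin n)

/-- The orthogonal group `O(n)`, as the group of linear isometries of `ℝⁿ`. -/
abbrev OrthogonalGrp (n : ℕ) : Type := RSpace n ≃ₗᵢ[ℝ] RSpace n

section Riemannian

variable {n : ℕ} {M : Type*} [TopologicalSpace M] [ChartedSpace (RSpace n) M]

variable [IsManifold (𝓡 n) ∞ M] [RiemannianBundle (fun x : M ↦ TangentSpace (𝓡 n) x)]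

/-- The metric tensor in the preferred chart around `x`: the number `g_{ab}(z) uᵃ vᵇ`, for a
point `z` of the target of the chart and for `u`, `v` read as coordinate vectors in that chart. -/
def chartMetric (x : M) (z u v : RSpace n) : ℝ :=
  let p : M := (extChartAt (𝓡 n) x).symm z
  let e := trivializationAt (RSpace n) (TangentSpace (𝓡 n) : M → Type) x
  inner ℝ (e.symmL ℝ p u) (e.symmL ℝ p v)

/-- The Christoffel symbols of the first kind of the metric, in the preferred chart around `x` and
at the point `x`, as a trilinear form:
`Γ(u, v, w) = ½ (∂_u g(v, w) + ∂_v g(u, w) - ∂_w g(u, v)) = ⟨∇_u v, w⟩`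
for `u`, `v`, `w` extended to vector fields with constant coordinates. -/
def christoffel (x : M) (u v w : TangentSpace (𝓡 n) x) : ℝ :=
  let z := extChartAt (𝓡 n) x x
  (fderiv ℝ (fun z' ↦ chartMetric x z' v w) z u + fderiv ℝ (fun z' ↦ chartMetric x z' u w) z v
    - fderiv ℝ (fun z' ↦ chartMetric x z' u v) z w) / 2

/-- The velocity at time `t` of a curve `γ : [0, 1] → M`, in the preferred chart around `γ t`
(in which `TangentSpace (𝓡 n) (γ t)` is by definition `ℝⁿ`). -/
def velocity (γ : ℝ → M) (t : ℝ) : TangentSpace (𝓡 n) (γ t) :=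
  derivWithin (fun s ↦ extChartAt (𝓡 n) (γ t) (γ s)) (Icc 0 1) t

/-- Let `Y : [0, 1] → TM` be a vector field along the curve `γ = π ∘ Y`.
`HasCovariantDerivAt Y t ξ` says that `Y` is differentiable at `t` and that `ξ ∈ T_{γ(t)} M` is its
covariant derivative `DY/dt` at `t`, for the Levi-Civita connection. In the preferred
chart around `γ t`, this is `⟨ξ, w⟩ = ⟨Y', w⟩ + Γ(γ', Y, w)` for all `w`. -/
def HasCovariantDerivAt (Y : ℝ → TangentBundle (𝓡 n) M) (t : ℝ) (ξ : TangentSpace (𝓡 n) (Y t).proj) : Prop :=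
  ∃ Y' : TangentSpace (𝓡 n) (Y t).proj,
    HasDerivWithinAt
      (fun s ↦ (trivializationAt (RSpace n) (TangentSpace (𝓡 n) : M → Type) (Y t).proj (Y s)).2)
      Y' (Icc 0 1) t ∧
    ∀ w : TangentSpace (𝓡 n) (Y t).proj,
      inner ℝ ξ w = inner ℝ Y' w + christoffel (Y t).proj (velocity (fun s ↦ (Y s).proj) t) (Y t).2 w

/-- `Y : [0, 1] → TM` is a smooth curve `γ = π ∘ Y` in `M` together with a parallel vector field
along it. -/
structure IsParallelField (Y : ℝ → TangentBundle (𝓡 n) M) : Prop where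
  smooth : ContMDiffOn 𝓘(ℝ) (𝓡 n) ∞ (fun s ↦ (Y s).proj) (Icc 0 1)
  parallel : ∀ t ∈ Icc (0 : ℝ) 1, HasCovariantDerivAt Y t 0

/-- `P : T_x M → T_y M` is the parallel transport along the smooth curve `γ : [0, 1] → M`
from `x` to `y`: for every `v`, the parallel field along `γ` with initial value `v` has final value
`P v`. -/
def IsTransportAlong (γ : ℝ → M) {x y : M} (P : TangentSpace (𝓡 n) x ≃ₗ[ℝ] TangentSpace (𝓡 n) y) : Prop :=
  γ 0 = x ∧ γ 1 = y ∧ ∀ v : TangentSpace (𝓡 n) x, ∃ Y : ℝ → TangentBundle (𝓡 n) M,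
    (∀ t ∈ Icc (0 : ℝ) 1, (Y t).proj = γ t) ∧ IsParallelField Y ∧ Y 0 = ⟨x, v⟩ ∧ Y 1 = ⟨y, P v⟩

/-- `P : T_x M → T_y M` is the parallel transport along some piecewise smooth curve from `x` to `y`,
that is, the composite of the transports along finitely many successive smooth curves. -/
inductive IsParallelTransport :
    ∀ {x y : M}, (TangentSpace (𝓡 n) x ≃ₗ[ℝ] TangentSpace (𝓡 n) y) → Prop
  | refl (x : M) : IsParallelTransport (LinearEquiv.refl ℝ (TangentSpace (𝓡 n) x))
  | along {x y : M} {P : TangentSpace (𝓡 n) x ≃ₗ[ℝ] TangentSpace (𝓡 n) y} (γ : ℝ → M) :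
      IsTransportAlong γ P → IsParallelTransport P
  | trans {x y z : M} {P : TangentSpace (𝓡 n) x ≃ₗ[ℝ] TangentSpace (𝓡 n) y}
      {Q : TangentSpace (𝓡 n) y ≃ₗ[ℝ] TangentSpace (𝓡 n) z} :
      IsParallelTransport P → IsParallelTransport Q → IsParallelTransport (P.trans Q)

lemma chartMetric_neg_left (x : M) (z u v : RSpace n) :
    chartMetric x z (-u) v = -chartMetric x z u v := by
  simp only [chartMetric]
  rw [map_neg, inner_neg_left]

lemma christoffel_neg (x : M) (u v w : TangentSpace (𝓡 n) x) :
    christoffel x (-u) v w = -christoffel x u v w := by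
  have h (u v w : RSpace n) : christoffel x (-u) v w = -christoffel x u v w := by
    simp only [christoffel, chartMetric_neg_left, map_neg, fderiv_fun_neg, neg_apply]
    ring
  exact h u v w

lemma IsParallelField.reverse {Y : ℝ → TangentBundle (𝓡 n) M} (hY : IsParallelField Y) :
    IsParallelField (fun t ↦ Y (1 - t)) where
  smooth := by
    refine hY.smooth.comp (f := fun t : ℝ ↦ 1 - t) ?_ ?_
    · exact (contDiff_const.sub contDiff_id).contMDiff.contMDiffOn
    · intro t ht
      exact ⟨by linarith [ht.2], by linarith [ht.1]⟩
  parallel t ht := by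
    have hmap : MapsTo (fun s : ℝ ↦ 1 - s) (Icc 0 1) (Icc 0 1) :=
      fun s hs ↦ ⟨by linarith [hs.2], by linarith [hs.1]⟩
    have ht' := hmap ht
    have hd : HasDerivWithinAt (fun s : ℝ ↦ 1 - s) (-1) (Icc 0 1) t := by
      simpa using (hasDerivWithinAt_id t (Icc (0 : ℝ) 1)).const_sub 1
    obtain ⟨Y', hY', h⟩ := hY.parallel (1 - t) ht'
    refine ⟨-Y', ?_, fun w ↦ ?_⟩
    · have := HasDerivWithinAt.scomp t hY' hd hmap
      have e : (-1 : ℝ) • (show RSpace n from Y') = -(show RSpace n from Y') := neg_one_smul ℝ _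
      exact this.congr_deriv e
    · have hv : velocity (n := n) (fun s ↦ (Y (1 - s)).proj) t =
          -velocity (n := n) (fun s ↦ (Y s).proj) (1 - t) := by
        have hg : DifferentiableWithinAt ℝ
            (fun s ↦ extChartAt (𝓡 n) (Y (1 - t)).proj (Y s).proj) (Icc 0 1) (1 - t) := by
          have h1 := (contMDiffAt_extChartAt (I := 𝓡 n) (n := ∞)
            (x := (Y (1 - t)).proj)).comp_contMDiffWithinAt (1 - t) (hY.smooth (1 - t) ht')
          exact (contMDiffWithinAt_iff_contDiffWithinAt.mp h1).differentiableWithinAt (by simp)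
        have h2 := (HasDerivWithinAt.scomp t hg.hasDerivWithinAt hd hmap).derivWithin
          (uniqueDiffOn_Icc zero_lt_one t ht)
        have e := neg_one_smul ℝ (derivWithin
          (fun s ↦ extChartAt (𝓡 n) (Y (1 - t)).proj (Y s).proj) (Icc 0 1) (1 - t))
        exact h2.trans e
      have h' := h w
      rw [inner_zero_left] at h' ⊢
      have hc := christoffel_neg (Y (1 - t)).proj (velocity (fun s ↦ (Y s).proj) (1 - t))
        (Y (1 - t)).2 w
      rw [← hv] at hc
      have hi := inner_neg_left (𝕜 := ℝ) Y' w
      change 0 = inner ℝ (-Y') w + christoffel (Y (1 - t)).proj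
        (velocity (fun s ↦ (Y (1 - s)).proj) t) (Y (1 - t)).2 w
      linarith

lemma IsTransportAlong.reverse {γ : ℝ → M} {x y : M}
    {P : TangentSpace (𝓡 n) x ≃ₗ[ℝ] TangentSpace (𝓡 n) y} (h : IsTransportAlong γ P) :
    IsTransportAlong (fun t ↦ γ (1 - t)) P.symm := by
  refine ⟨by simpa using h.2.1, by simpa using h.1, fun v ↦ ?_⟩
  obtain ⟨Y, hγ, hY, h0, h1⟩ := h.2.2 (P.symm v)
  refine ⟨fun t ↦ Y (1 - t), fun t ht ↦ hγ _ ⟨by linarith [ht.2], by linarith [ht.1]⟩, hY.reverse,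
    by simpa using h1, by simpa using h0⟩

lemma IsParallelTransport.symm {x y : M} {P : TangentSpace (𝓡 n) x ≃ₗ[ℝ] TangentSpace (𝓡 n) y}
    (h : IsParallelTransport P) : IsParallelTransport P.symm := by
  induction h with
  | refl x => exact .refl x
  | along γ h => exact .along _ h.reverse
  | trans _ _ ihP ihQ => exact .trans ihQ ihP

/-- The holonomy group at `x` of the Levi-Civita connection: all parallel transports around
piecewise smooth loops at `x`. -/
def holonomy (x : M) : Subgroup (TangentSpace (𝓡 n) x ≃ₗ[ℝ] TangentSpace (𝓡 n) x) where
  carrier := {P | IsParallelTransport P}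
  one_mem' := .refl x
  mul_mem' hP hQ := .trans hQ hP
  inv_mem' hP := hP.symm

variable (M) in
/-- For a subgroup `G ⊆ O(n)`, an `n`-dimensional Riemannian manifold is a `G`-manifold if its
holonomy group at every point `x` is contained in `G`, for some isometric identification
`φ : ℝⁿ → T_x M`. -/
def IsGManifold (G : Subgroup (OrthogonalGrp n)) : Prop :=
  ∀ x : M, ∃ φ : RSpace n ≃ₗᵢ[ℝ] TangentSpace (𝓡 n) x,
    ∀ P ∈ holonomy x, ∃ g ∈ G, ∀ v, P (φ v) = φ (g v)

end Riemannian

/-! ### The groups -/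

/-- `ℂᵐ` with its Hermitian inner product. -/
abbrev CSpace (m : ℕ) : Type := EuclideanSpace ℂ (Fin m)

/-- The identification of `ℂᵐ` with `ℝ²ᵐ`: the real coordinates of `z` are
`re z₀, im z₀, re z₁, im z₁, …`. -/
def realCoords (m : ℕ) : CSpace m ≃ₗᵢ[ℝ] RSpace (m * 2) where
  toFun z := WithLp.toLp 2 fun i ↦
    if (finProdFinEquiv.symm i).2 = 0 then (z (finProdFinEquiv.symm i).1).re
    else (z (finProdFinEquiv.symm i).1).im
  invFun x := WithLp.toLp 2 fun k ↦ ⟨x (finProdFinEquiv (k, 0)), x (finProdFinEquiv (k, 1))⟩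
  map_add' z w := by
    ext i
    obtain ⟨⟨k, ε⟩, rfl⟩ := finProdFinEquiv.surjective i
    fin_cases ε <;> simp [-finProdFinEquiv_symm_apply]
  map_smul' a z := by
    ext i
    obtain ⟨⟨k, ε⟩, rfl⟩ := finProdFinEquiv.surjective i
    fin_cases ε <;> simp [-finProdFinEquiv_symm_apply]
  left_inv z := by ext k; simp [-finProdFinEquiv_symm_apply]
  right_inv x := by
    ext i
    obtain ⟨⟨k, ε⟩, rfl⟩ := finProdFinEquiv.surjective i
    fin_cases ε <;> simp [-finProdFinEquiv_symm_apply]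
  norm_map' z := by
    simp only [LinearEquiv.coe_mk, EuclideanSpace.norm_eq]
    congr 1
    rw [← finProdFinEquiv.sum_comp, Fintype.sum_prod_type]
    refine Finset.sum_congr rfl fun k _ ↦ ?_
    rw [← Complex.normSq_eq_norm_sq, Complex.normSq_apply]
    simp [-finProdFinEquiv_symm_apply, ← pow_two]

/-- A matrix acting on `ℂᵐ = ℝ²ᵐ`. -/
def realAction {m : ℕ} (A : Matrix (Fin m) (Fin m) ℂ) : RSpace (m * 2) →ₗ[ℝ] RSpace (m * 2) where
  toFun v := realCoords m (Matrix.toEuclideanLin A ((realCoords m).symm v))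
  map_add' v w := by simp
  map_smul' a v := by
    have h : Matrix.toEuclideanLin A (a • (realCoords m).symm v) =
        a • Matrix.toEuclideanLin A ((realCoords m).symm v) :=
      ((Matrix.toEuclideanLin A).restrictScalars ℝ).map_smul a _
    simp [h]

lemma realAction_mul {m : ℕ} (A B : Matrix (Fin m) (Fin m) ℂ) (v : RSpace (m * 2)) :
    realAction (A * B) v = realAction A (realAction B v) := by
  simp [realAction]

lemma realAction_one {m : ℕ} (v : RSpace (m * 2)) :
    realAction (1 : Matrix (Fin m) (Fin m) ℂ) v = v := by
  simp [realAction]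

lemma norm_realAction {m : ℕ} (A : Matrix.specialUnitaryGroup (Fin m) ℂ) (v : RSpace (m * 2)) :
    ‖realAction A.1 v‖ = ‖v‖ := by
  have hA : A.1.conjTranspose * A.1 = 1 :=
    Matrix.mem_unitaryGroup_iff'.mp (Matrix.mem_specialUnitaryGroup_iff.mp A.2).1
  have key (z : CSpace m) : ‖Matrix.toEuclideanLin A.1 z‖ = ‖z‖ := by
    have h : inner ℂ (Matrix.toEuclideanLin A.1 z) (Matrix.toEuclideanLin A.1 z) = inner ℂ z z := by
      rw [← LinearMap.adjoint_inner_right, ← Matrix.toEuclideanLin_conjTranspose_eq_adjoint]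
      congr 1
      simp [Matrix.toLpLin_apply, hA]
    rw [inner_self_eq_norm_sq_to_K, inner_self_eq_norm_sq_to_K] at h
    have h' : ‖Matrix.toEuclideanLin A.1 z‖ ^ 2 = ‖z‖ ^ 2 := by exact_mod_cast h
    exact (sq_eq_sq₀ (norm_nonneg _) (norm_nonneg _)).mp h'
  change ‖realCoords m (Matrix.toEuclideanLin A.1 ((realCoords m).symm v))‖ = ‖v‖
  rw [LinearIsometryEquiv.norm_map, key, LinearIsometryEquiv.norm_map]

/-- The inclusion `SU(m) ⊂ O(2m)`. -/
def suToOrthogonal (m : ℕ) :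
    Matrix.specialUnitaryGroup (Fin m) ℂ →* OrthogonalGrp (m * 2) where
  toFun A :=
    { realAction A.1 with
      invFun := realAction A⁻¹.1
      left_inv := fun v ↦ by
        change realAction A⁻¹.1 (realAction A.1 v) = v
        rw [← realAction_mul, ← Submonoid.coe_mul, inv_mul_cancel, Submonoid.coe_one, realAction_one]
      right_inv := fun v ↦ by
        change realAction A.1 (realAction A⁻¹.1 v) = v
        rw [← realAction_mul, ← Submonoid.coe_mul, mul_inv_cancel, Submonoid.coe_one, realAction_one]
      norm_map' := norm_realAction A }
  map_one' := by ext1 v; exact realAction_one v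
  map_mul' A B := by ext1 v; exact realAction_mul A.1 B.1 v

/-- `SU(m)` as a subgroup of `O(2m)`. -/
def SU (m : ℕ) : Subgroup (OrthogonalGrp (m * 2)) := (suToOrthogonal m).range

/-- The block diagonal matrix with diagonal blocks `g` (of size 3) and `h` (of size 2). -/
def blockDiag (g : Matrix (Fin 3) (Fin 3) ℂ) (h : Matrix (Fin 2) (Fin 2) ℂ) :
    Matrix (Fin 5) (Fin 5) ℂ :=
  (Matrix.fromBlocks g 0 0 h).submatrix (finSumFinEquiv (m := 3) (n := 2)).symm
    (finSumFinEquiv (m := 3) (n := 2)).symm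

lemma blockDiag_mul (g g' : Matrix (Fin 3) (Fin 3) ℂ) (h h' : Matrix (Fin 2) (Fin 2) ℂ) :
    blockDiag g h * blockDiag g' h' = blockDiag (g * g') (h * h') := by
  simp [blockDiag, Matrix.submatrix_mul_equiv, Matrix.fromBlocks_multiply]

lemma blockDiag_one : blockDiag 1 1 = 1 := by simp [blockDiag]

lemma star_blockDiag (g : Matrix (Fin 3) (Fin 3) ℂ) (h : Matrix (Fin 2) (Fin 2) ℂ) :
    star (blockDiag g h) = blockDiag (star g) (star h) := by
  simp [blockDiag, Matrix.star_eq_conjTranspose, Matrix.conjTranspose_submatrix,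
    Matrix.fromBlocks_conjTranspose]

/-- `S(U(3) × U(2))`, the subgroup of `SU(5)` of the block diagonal matrices
with blocks `g ∈ U(3)` and `h ∈ U(2)`. -/
def SU3U2 : Subgroup (Matrix.specialUnitaryGroup (Fin 5) ℂ) where
  carrier := {A | ∃ g ∈ Matrix.unitaryGroup (Fin 3) ℂ, ∃ h ∈ Matrix.unitaryGroup (Fin 2) ℂ,
    A.1 = blockDiag g h}
  one_mem' := ⟨1, one_mem _, 1, one_mem _, blockDiag_one.symm⟩
  mul_mem' := by
    rintro A B ⟨g, hg, h, hh, hA⟩ ⟨g', hg', h', hh', hB⟩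
    exact ⟨g * g', mul_mem hg hg', h * h', mul_mem hh hh', by
      rw [Submonoid.coe_mul, hA, hB, blockDiag_mul]⟩
  inv_mem' := by
    rintro A ⟨g, hg, h, hh, hA⟩
    refine ⟨star g, Unitary.star_mem hg, star h, Unitary.star_mem hh, ?_⟩
    rw [← star_blockDiag, ← hA]
    rfl

/-- `𝒢 = S(U(3) × U(2)) ⊂ SU(5) ⊂ O(10)`. -/
def smGroup : Subgroup (OrthogonalGrp 10) := SU3U2.map (suToOrthogonal 5)

/-- The 3-dimensional complex subspace `ℂ³ = {z₃ = z₄ = 0}` of `ℂ⁵`. -/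
def stdThree : Submodule ℂ (CSpace 5) where
  carrier := {z | z 3 = 0 ∧ z 4 = 0}
  zero_mem' := by simp
  add_mem' := by
    rintro z w ⟨h, h'⟩ ⟨k, k'⟩
    simp [h, h', k, k']
  smul_mem' := by
    rintro a z ⟨h, h'⟩
    simp [h, h']

/-- The 2-dimensional complex subspace `ℂ² = {z₀ = z₁ = z₂ = 0}` of `ℂ⁵`. -/
def stdTwo : Submodule ℂ (CSpace 5) where
  carrier := {z | z 0 = 0 ∧ z 1 = 0 ∧ z 2 = 0}
  zero_mem' := by simp
  add_mem' := by
    rintro z w ⟨h, h', h''⟩ ⟨k, k', k''⟩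
    simp [h, h', h'', k, k', k'']
  smul_mem' := by
    rintro a z ⟨h, h', h''⟩
    simp [h, h', h'']

/-! ### Calabi–Yau structures and parallel splittings -/

section CalabiYau

variable {M : Type*} [TopologicalSpace M] [ChartedSpace (RSpace 10) M] [IsManifold (𝓡 10) ∞ M]
  [RiemannianBundle (fun x : M ↦ TangentSpace (𝓡 10) x)]

/-- `J` is a Kähler structure: a field of complex structures on the tangent spaces that is
compatible with the metric and preserved by parallel transport. -/
structure IsKaehlerStructure (J : ∀ x : M, TangentSpace (𝓡 10) x →ₗ[ℝ] TangentSpace (𝓡 10) x) :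
    Prop where
  sq : ∀ x v, J x (J x v) = -v
  isometry : ∀ x v w, inner ℝ (J x v) (J x w) = inner ℝ v w
  parallel : ∀ (x y : M) (P : TangentSpace (𝓡 10) x ≃ₗ[ℝ] TangentSpace (𝓡 10) y),
    IsParallelTransport P → ∀ v, P (J x v) = J y (P v)

/-- `J` is the complex structure of a Calabi–Yau manifold of real dimension 10: it is a Kähler
structure and, for some identification of the complex inner product space `(T_x M, J_x)` with
`ℂ⁵ = ℝ¹⁰`, the holonomy group at `x` is contained in `SU(5)`. -/
structure IsCalabiYauStructure
    (J : ∀ x : M, TangentSpace (𝓡 10) x →ₗ[ℝ] TangentSpace (𝓡 10) x) : Prop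
    extends IsKaehlerStructure J where
  holonomy_le : ∀ x : M, ∃ φ : RSpace 10 ≃ₗᵢ[ℝ] TangentSpace (𝓡 10) x,
    (∀ z : CSpace 5, φ (realCoords 5 (Complex.I • z)) = J x (φ (realCoords 5 z))) ∧
    ∀ P ∈ holonomy x, ∃ g ∈ SU 5, ∀ v, P (φ v) = φ (g v)

/-- The tangent spaces split into orthogonal subspaces `V x` and `W x` of dimensions 4 and 6, each
preserved by `J` and by parallel transport. -/
structure IsParallelSplitting (J : ∀ x : M, TangentSpace (𝓡 10) x →ₗ[ℝ] TangentSpace (𝓡 10) x)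
    (V W : ∀ x : M, Submodule ℝ (TangentSpace (𝓡 10) x)) : Prop where
  finrank_four : ∀ x, Module.finrank ℝ (V x) = 4
  finrank_six : ∀ x, Module.finrank ℝ (W x) = 6
  isCompl : ∀ x, IsCompl (V x) (W x)
  orthogonal : ∀ x, ∀ v ∈ V x, ∀ w ∈ W x, inner ℝ v w = 0
  complex_four : ∀ x, ∀ v ∈ V x, J x v ∈ V x
  complex_six : ∀ x, ∀ w ∈ W x, J x w ∈ W x
  parallel_four : ∀ (x y : M) (P : TangentSpace (𝓡 10) x ≃ₗ[ℝ] TangentSpace (𝓡 10) y),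
    IsParallelTransport P → ∀ v ∈ V x, P v ∈ V y
  parallel_six : ∀ (x y : M) (P : TangentSpace (𝓡 10) x ≃ₗ[ℝ] TangentSpace (𝓡 10) y),
    IsParallelTransport P → ∀ w ∈ W x, P w ∈ W y

end CalabiYau

end

/-!
The definition of a `G`-manifold only mentions holonomy, that is, parallel transport around loops.
To pass to transports between different points, choose a base point in each class of points
that are joined by some parallel transport and carry its frame `ℝⁿ ≅ T_x M` to all other points of
the class. Every transport then lies in `G` with respect to these frames
(`IsGManifold.exists_frames`). The transported frames are isometric because parallel transport is:
in the preferred chart at `γ t`, the derivative of `⟨Y, Y⟩` along a parallel field `Y` is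
`∂_{γ'} g(Y, Y) + 2 g(Y', Y)`, which vanishes since `Γ(γ', Y, Y) = ½ ∂_{γ'} g(Y, Y)`
(`IsParallelField.hasDerivWithinAt_inner`, `IsParallelTransport.norm_map`).

For `G = 𝒢` the frames carry multiplication by `i` and the splitting `ℂ⁵ = ℂ² ⊕ ℂ³` to the tangent
spaces, and both are parallel because `𝒢` consists of the elements of `SU(5)` that preserve the two
summands (`mem_SU3U2_iff`, `calabiYau_splitting_of_frames`).

Conversely, let a Calabi–Yau structure and a parallel splitting `V ⊕ W` be given. In a frame in
which the holonomy lies in `SU(5)`, both `V x` and `W x` are complex subspaces, and they are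
orthogonal for the Hermitian inner product. Hence a unitary change of the frame makes the
splitting standard (`exists_adapted_frame`). Conjugation by a unitary map preserves `SU(5)`, so the
holonomy stays in `SU(5)`; it preserves the standard splitting, so it lies in `𝒢`
(`IsParallelSplitting.isGManifold`).
-/

/-! ### Parallel transport is isometric -/

section Isometry

variable {n : ℕ} {M : Type*} [TopologicalSpace M] [ChartedSpace (RSpace n) M]
  [IsManifold (𝓡 n) ∞ M]

lemma mem_trivializationAt_baseSet_of_mem_target {x : M} {z : RSpace n}
    (hz : z ∈ (extChartAt (𝓡 n) x).target) :
    (extChartAt (𝓡 n) x).symm z ∈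
      (trivializationAt (RSpace n) (TangentSpace (𝓡 n) : M → Type) x).baseSet := by
  simpa using (extChartAt (𝓡 n) x).map_target hz

lemma contMDiffAt_symmL_extChartAt_symm {x : M} {z : RSpace n}
    (hz : z ∈ (extChartAt (𝓡 n) x).target) (u : RSpace n) :
    ContMDiffAt (𝓘(ℝ, RSpace n × RSpace n)) (𝓡 n).tangent ∞
      (fun q : RSpace n × RSpace n ↦
        (⟨(extChartAt (𝓡 n) x).symm q.1,
          (trivializationAt (RSpace n) (TangentSpace (𝓡 n) : M → Type) x).symmL ℝ
            ((extChartAt (𝓡 n) x).symm q.1) q.2⟩ : TangentBundle (𝓡 n) M)) (z, u) := by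
  have h1 : ContMDiffAt 𝓘(ℝ, RSpace n) (𝓡 n) ∞ (extChartAt (𝓡 n) x).symm z :=
    (contMDiffOn_extChartAt_symm x).contMDiffAt (extChartAt_target_mem_nhds' hz)
  have h2 : ContMDiffAt 𝓘(ℝ, RSpace n × RSpace n) (𝓡 n) ∞
      (fun q : RSpace n × RSpace n ↦ (extChartAt (𝓡 n) x).symm q.1) (z, u) :=
    ContMDiffAt.comp (z, u) (g := (extChartAt (𝓡 n) x).symm) h1 contDiff_fst.contMDiff.contMDiffAt
  rw [Trivialization.contMDiffAt_iff _
    (e := trivializationAt (RSpace n) (TangentSpace (𝓡 n) : M → Type) x)]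
  · refine ⟨h2, ?_⟩
    refine (contDiff_snd.contMDiff.contMDiffAt
      (f := (Prod.snd : RSpace n × RSpace n → RSpace n))).congr_of_eventuallyEq ?_
    have h3 : ∀ᶠ q : RSpace n × RSpace n in 𝓝 (z, u), q.1 ∈ (extChartAt (𝓡 n) x).target :=
      continuousAt_fst.eventually (extChartAt_target_mem_nhds' hz)
    filter_upwards [h3] with q hq
    have := Trivialization.apply_mk_symm
      (trivializationAt (RSpace n) (TangentSpace (𝓡 n) : M → Type) x)
      (mem_trivializationAt_baseSet_of_mem_target hq) q.2
    rw [Trivialization.symmL_apply _ (mem_trivializationAt_baseSet_of_mem_target hq), this]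
  · rw [Trivialization.mem_source]
    exact mem_trivializationAt_baseSet_of_mem_target hz

variable [RiemannianBundle (fun x : M ↦ TangentSpace (𝓡 n) x)]

lemma chartMetric_comm (x : M) (z u v : RSpace n) : chartMetric x z u v = chartMetric x z v u :=
  real_inner_comm _ _

lemma chartMetric_add_left (x : M) (z u u' v : RSpace n) :
    chartMetric x z (u + u') v = chartMetric x z u v + chartMetric x z u' v := by
  simp only [chartMetric]
  rw [map_add, inner_add_left]

lemma chartMetric_smul_left (x : M) (z : RSpace n) (a : ℝ) (u v : RSpace n) :
    chartMetric x z (a • u) v = a * chartMetric x z u v := by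
  simp only [chartMetric]
  rw [map_smul, real_inner_smul_left]

/-- At the centre of the preferred chart, coordinate vectors are tangent vectors. -/
lemma chartMetric_extChartAt_self (x : M) (u v : TangentSpace (𝓡 n) x) :
    chartMetric x (extChartAt (𝓡 n) x x) u v = inner ℝ u v := by
  have h (w : RSpace n) :
      (trivializationAt (RSpace n) (TangentSpace (𝓡 n) : M → Type) x).symmL ℝ x w = w := by
    rw [TangentBundle.symmL_trivializationAt_eq_core (mem_chart_source _ x)]
    exact (tangentBundleCore (𝓡 n) M).coordChange_self _ _ (mem_achart_source _ x) _
  simp only [chartMetric]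
  rw [extChartAt_to_inv]
  exact congrArg₂ (fun a b : TangentSpace (𝓡 n) x ↦ inner ℝ a b) (h u) (h v)

lemma chartMetric_trivializationAt {x : M} {Y : TangentBundle (𝓡 n) M}
    (hY : Y.proj ∈ (extChartAt (𝓡 n) x).source) :
    chartMetric x (extChartAt (𝓡 n) x Y.proj)
      (trivializationAt (RSpace n) (TangentSpace (𝓡 n) : M → Type) x Y).2
      (trivializationAt (RSpace n) (TangentSpace (𝓡 n) : M → Type) x Y).2 =
    inner ℝ Y.2 Y.2 := by
  obtain ⟨p, w⟩ := Y
  have hb : p ∈ (trivializationAt (RSpace n) (TangentSpace (𝓡 n) : M → Type) x).baseSet := by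
    simpa using hY
  simp only [chartMetric]
  rw [(extChartAt (𝓡 n) x).left_inv hY]
  have h : (trivializationAt (RSpace n) (TangentSpace (𝓡 n) : M → Type) x).symmL ℝ p
      (trivializationAt (RSpace n) (TangentSpace (𝓡 n) : M → Type) x ⟨p, w⟩).2 = w := by
    rw [Trivialization.symmL_apply _ hb, Trivialization.symm_apply_apply_mk _ hb]
  exact congrArg₂ (fun a b : TangentSpace (𝓡 n) p ↦ inner ℝ a b) h h

/-- The Levi-Civita connection is metric. -/
lemma christoffel_self_right (x : M) (u v : TangentSpace (𝓡 n) x) :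
    christoffel x u v v =
      fderiv ℝ (fun z ↦ chartMetric x z v v) (extChartAt (𝓡 n) x x) u / 2 := by
  simp only [christoffel]
  ring

variable [IsContMDiffRiemannianBundle (𝓡 n) ∞ (RSpace n) (fun x : M ↦ TangentSpace (𝓡 n) x)]

lemma differentiableAt_chartMetric (x : M) (u v : RSpace n) :
    DifferentiableAt ℝ (fun q : RSpace n × RSpace n × RSpace n ↦ chartMetric x q.1 q.2.1 q.2.2)
      (extChartAt (𝓡 n) x x, u, v) := by
  have hz := mem_extChartAt_target (I := 𝓡 n) x
  have hu : ContMDiffAt 𝓘(ℝ, RSpace n × RSpace n × RSpace n) 𝓘(ℝ, RSpace n × RSpace n) ∞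
      (fun q : RSpace n × RSpace n × RSpace n ↦ (q.1, q.2.1)) (extChartAt (𝓡 n) x x, u, v) :=
    (contDiff_fst.prodMk (contDiff_fst.comp contDiff_snd)).contMDiff.contMDiffAt
  have hv : ContMDiffAt 𝓘(ℝ, RSpace n × RSpace n × RSpace n) 𝓘(ℝ, RSpace n × RSpace n) ∞
      (fun q : RSpace n × RSpace n × RSpace n ↦ (q.1, q.2.2)) (extChartAt (𝓡 n) x x, u, v) :=
    (contDiff_fst.prodMk (contDiff_snd.comp contDiff_snd)).contMDiff.contMDiffAt
  have hu' := ContMDiffAt.comp (extChartAt (𝓡 n) x x, u, v)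
    (contMDiffAt_symmL_extChartAt_symm hz u) hu
  have hv' := ContMDiffAt.comp (extChartAt (𝓡 n) x x, u, v)
    (contMDiffAt_symmL_extChartAt_symm hz v) hv
  have h := ContMDiffAt.inner_bundle (IB := 𝓡 n) (F := RSpace n)
    (E := fun x : M ↦ TangentSpace (𝓡 n) x) hu' hv'
  exact (contMDiffAt_iff_contDiffAt.mp h).differentiableAt (by simp)

/-- Derivative of the squared length of a vector field along a curve in the preferred chart at `x`,
at a time when the curve passes through `x`. -/
lemma hasDerivWithinAt_chartMetric {x : M} {s : Set ℝ} {t : ℝ} {z y : ℝ → RSpace n}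
    {z' y' : RSpace n} (hz : HasDerivWithinAt z z' s t) (hy : HasDerivWithinAt y y' s t)
    (hzt : z t = extChartAt (𝓡 n) x x) :
    HasDerivWithinAt (fun r ↦ chartMetric x (z r) (y r) (y r))
      (fderiv ℝ (fun p ↦ chartMetric x p (y t) (y t)) (z t) z' +
        2 * chartMetric x (z t) y' (y t)) s t := by
  -- The chain rule, with the total derivative of `(z, u, v) ↦ g_z(u, v)` split into its three
  -- partial derivatives; the last two come from the linearity in `u` and in `v`.
  set F : RSpace n × RSpace n × RSpace n → ℝ := fun q ↦ chartMetric x q.1 q.2.1 q.2.2 with hF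
  have hd : HasFDerivAt F (fderiv ℝ F (z t, y t, y t)) (z t, y t, y t) := by
    rw [hzt]
    exact (differentiableAt_chartMetric x (y t) (y t)).hasFDerivAt
  have h := hd.comp_hasDerivWithinAt t (hz.prodMk (hy.prodMk hy))
  refine h.congr_deriv ?_
  have e1 : fderiv ℝ (fun p ↦ chartMetric x p (y t) (y t)) (z t) z' =
      fderiv ℝ F (z t, y t, y t) (z', 0, 0) := by
    have := (hd.comp (z t) (hasFDerivAt_prodMk_left (𝕜 := ℝ) (z t) (y t, y t))).fderiv
    have h2 := congrArg (fun L ↦ L z') this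
    exact h2
  have hlin (u w : RSpace n) (c : ℝ) : HasDerivAt (fun r : ℝ ↦ c + r * chartMetric x (z t) u w)
      (chartMetric x (z t) u w) 0 := by
    simpa using ((hasDerivAt_id (0 : ℝ)).mul_const (chartMetric x (z t) u w)).const_add c
  have hline (w : RSpace n × RSpace n × RSpace n) :
      HasDerivAt (fun r : ℝ ↦ F ((z t, y t, y t) + r • w)) (fderiv ℝ F (z t, y t, y t) w) 0 := by
    have := (hd.hasLineDerivAt w)
    exact this
  have e2 : fderiv ℝ F (z t, y t, y t) (0, y', 0) = chartMetric x (z t) y' (y t) := by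
    refine (hline (0, y', 0)).unique ?_
    refine (hlin y' (y t) (chartMetric x (z t) (y t) (y t))).congr_of_eventuallyEq
      (Filter.Eventually.of_forall fun r ↦ ?_)
    simp [hF, chartMetric_add_left, chartMetric_smul_left]
  have e3 : fderiv ℝ F (z t, y t, y t) (0, 0, y') = chartMetric x (z t) y' (y t) := by
    refine (hline (0, 0, y')).unique ?_
    refine (hlin y' (y t) (chartMetric x (z t) (y t) (y t))).congr_of_eventuallyEq
      (Filter.Eventually.of_forall fun r ↦ ?_)
    simp [hF, chartMetric_comm x (z t) (y t), chartMetric_add_left, chartMetric_smul_left]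
  have hsum : (z', y', y') = (z', (0 : RSpace n), (0 : RSpace n)) + ((0, y', 0) + (0, 0, y')) := by
    simp
  rw [hsum, map_add, map_add, e1, e2, e3]
  ring

/-- A parallel field has constant length, because the connection is metric. -/
lemma IsParallelField.hasDerivWithinAt_inner {Y : ℝ → TangentBundle (𝓡 n) M}
    (hY : IsParallelField Y) {t : ℝ} (ht : t ∈ Icc (0 : ℝ) 1) :
    HasDerivWithinAt (fun s ↦ inner ℝ (Y s).2 (Y s).2) 0 (Icc 0 1) t := by
  set x := (Y t).proj
  obtain ⟨Y', hY', h⟩ := hY.parallel t ht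
  have hz : HasDerivWithinAt (fun s ↦ extChartAt (𝓡 n) x (Y s).proj)
      (velocity (n := n) (fun s ↦ (Y s).proj) t) (Icc 0 1) t := by
    have h1 := (contMDiffAt_extChartAt (I := 𝓡 n) (n := ∞)
      (x := x)).comp_contMDiffWithinAt t (hY.smooth t ht)
    exact ((contMDiffWithinAt_iff_contDiffWithinAt.mp h1).differentiableWithinAt
      (by simp)).hasDerivWithinAt
  have hd := hasDerivWithinAt_chartMetric (x := x) hz hY' rfl
  have hev : ∀ᶠ s in 𝓝[Icc 0 1] t, (Y s).proj ∈ (extChartAt (𝓡 n) x).source :=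
    (hY.smooth t ht).continuousWithinAt.eventually (extChartAt_source_mem_nhds x)
  have hself :
      (trivializationAt (RSpace n) (TangentSpace (𝓡 n) : M → Type) x (Y t)).2 = (Y t).2 := by
    rw [TangentBundle.trivializationAt_apply]
    exact (tangentBundleCore (𝓡 n) M).coordChange_self _ _ (mem_achart_source _ x) _
  refine (hd.congr_of_eventuallyEq (hev.mono fun s hs ↦ (chartMetric_trivializationAt hs).symm)
    (chartMetric_trivializationAt (mem_extChartAt_source x)).symm).congr_deriv ?_
  have h' := h (Y t).2
  rw [inner_zero_left, christoffel_self_right] at h'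
  have hm := chartMetric_extChartAt_self x Y' (Y t).2
  rw [hself]
  change fderiv ℝ (fun p ↦ chartMetric x p (Y t).2 (Y t).2) (extChartAt (𝓡 n) x x)
    (velocity (fun s ↦ (Y s).proj) t) + 2 * chartMetric x (extChartAt (𝓡 n) x x) Y' (Y t).2 = 0
  linarith

lemma IsTransportAlong.inner_self {γ : ℝ → M} {x y : M}
    {P : TangentSpace (𝓡 n) x ≃ₗ[ℝ] TangentSpace (𝓡 n) y} (hP : IsTransportAlong γ P)
    (v : TangentSpace (𝓡 n) x) : inner ℝ (P v) (P v) = inner ℝ v v := by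
  obtain ⟨Y, -, hY, h0, h1⟩ := hP.2.2 v
  have hc := constant_of_derivWithin_zero
    (fun t ht ↦ (hY.hasDerivWithinAt_inner ht).differentiableWithinAt)
    (fun t ht ↦ (hY.hasDerivWithinAt_inner (Ico_subset_Icc_self ht)).derivWithin
      (uniqueDiffOn_Icc zero_lt_one t (Ico_subset_Icc_self ht))) 1 (right_mem_Icc.mpr zero_le_one)
  rw [h0, h1] at hc
  exact hc

lemma IsParallelTransport.inner_self {x y : M}
    {P : TangentSpace (𝓡 n) x ≃ₗ[ℝ] TangentSpace (𝓡 n) y} (hP : IsParallelTransport P)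
    (v : TangentSpace (𝓡 n) x) : inner ℝ (P v) (P v) = inner ℝ v v := by
  induction hP with
  | refl x => rfl
  | along γ h => exact h.inner_self v
  | trans _ _ ihP ihQ => exact (ihQ _).trans (ihP v)

lemma IsParallelTransport.norm_map {x y : M}
    {P : TangentSpace (𝓡 n) x ≃ₗ[ℝ] TangentSpace (𝓡 n) y} (hP : IsParallelTransport P)
    (v : TangentSpace (𝓡 n) x) : ‖P v‖ = ‖v‖ := by
  have h := hP.inner_self v
  rw [real_inner_self_eq_norm_sq, real_inner_self_eq_norm_sq] at h
  exact (sq_eq_sq₀ (norm_nonneg _) (norm_nonneg _)).mp h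

/-! ### Frames adapted to the holonomy -/

/-- If the holonomy groups lie in `G`, the identifications `ℝⁿ → T_x M` can be chosen such that
*all* parallel transports lie in `G`: choose a base point in each class of points that are joined
by a parallel transport, and transport its frame to the other points of the class. -/
lemma IsGManifold.exists_frames {G : Subgroup (OrthogonalGrp n)} (hG : IsGManifold M G) :
    ∃ φ : ∀ x : M, RSpace n ≃ₗᵢ[ℝ] TangentSpace (𝓡 n) x,
      ∀ (x y : M) (P : TangentSpace (𝓡 n) x ≃ₗ[ℝ] TangentSpace (𝓡 n) y),
        IsParallelTransport P → ∃ g ∈ G, ∀ v, P (φ x v) = φ y (g v) := by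
  let r : Setoid M :=
    { r := fun x y ↦ ∃ P : TangentSpace (𝓡 n) x ≃ₗ[ℝ] TangentSpace (𝓡 n) y, IsParallelTransport P
      iseqv := ⟨fun x ↦ ⟨_, .refl x⟩, fun ⟨_, h⟩ ↦ ⟨_, h.symm⟩,
        fun ⟨_, h⟩ ⟨_, h'⟩ ↦ ⟨_, h.trans h'⟩⟩ }
  let b (x : M) : M := (Quotient.mk r x).out
  have hb (x : M) : ∃ Q : TangentSpace (𝓡 n) (b x) ≃ₗ[ℝ] TangentSpace (𝓡 n) x,
      IsParallelTransport Q := Quotient.mk_out (s := r) x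
  choose Q hQ using hb
  choose ψ hψ using hG
  refine ⟨fun x ↦ (ψ (b x)).trans ⟨Q x, (hQ x).norm_map⟩, fun x y P hP ↦ ?_⟩
  have hxy : b x = b y := congrArg Quotient.out (Quotient.sound (s := r) ⟨P, hP⟩)
  -- Conjugating `P` by two transports from a common base point `a` gives an element of the
  -- holonomy group at `a`.
  have key (a : M) (Q₁ : TangentSpace (𝓡 n) a ≃ₗ[ℝ] TangentSpace (𝓡 n) x)
      (h₁ : IsParallelTransport Q₁) (Q₂ : TangentSpace (𝓡 n) a ≃ₗ[ℝ] TangentSpace (𝓡 n) y)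
      (h₂ : IsParallelTransport Q₂) :
      ∃ g ∈ G, ∀ v, P (Q₁ (ψ a v)) = Q₂ (ψ a (g v)) := by
    obtain ⟨g, hg, h⟩ := hψ a ((Q₁.trans P).trans Q₂.symm) ((h₁.trans hP).trans h₂.symm)
    refine ⟨g, hg, fun v ↦ ?_⟩
    rw [← h v]
    simp
  -- Transports from `b x` and `b y` have different types, although `b x = b y`.
  have key' (a c : M) (hac : a = c) (Q₁ : TangentSpace (𝓡 n) a ≃ₗ[ℝ] TangentSpace (𝓡 n) x)
      (h₁ : IsParallelTransport Q₁) (Q₂ : TangentSpace (𝓡 n) c ≃ₗ[ℝ] TangentSpace (𝓡 n) y)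
      (h₂ : IsParallelTransport Q₂) :
      ∃ g ∈ G, ∀ v, P (Q₁ (ψ a v)) = Q₂ (ψ c (g v)) := by
    subst hac
    exact key a Q₁ h₁ Q₂ h₂
  exact key' _ _ hxy (Q x) (hQ x) (Q y) (hQ y)

end Isometry

/-! ### Linear algebra of `ℂ⁵ = ℂ² ⊕ ℂ³` -/

lemma mem_stdTwo {z : CSpace 5} : z ∈ stdTwo ↔ z 0 = 0 ∧ z 1 = 0 ∧ z 2 = 0 := Iff.rfl

lemma mem_stdThree {z : CSpace 5} : z ∈ stdThree ↔ z 3 = 0 ∧ z 4 = 0 := Iff.rfl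

lemma finrank_stdTwo : Module.finrank ℂ stdTwo = 2 := by
  let e : stdTwo ≃ₗ[ℂ] (Fin 2 → ℂ) :=
    { toFun := fun z ↦ ![z.1 3, z.1 4]
      invFun := fun a ↦ ⟨!₂[0, 0, 0, a 0, a 1], by simp [mem_stdTwo]⟩
      map_add' := fun z w ↦ by ext i; fin_cases i <;> simp
      map_smul' := fun a z ↦ by ext i; fin_cases i <;> simp
      left_inv := fun ⟨z, h₀, h₁, h₂⟩ ↦ by ext i; fin_cases i <;> simp [h₀, h₁, h₂]
      right_inv := fun a ↦ by ext i; fin_cases i <;> simp }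
  simp [e.finrank_eq]

lemma finrank_stdThree : Module.finrank ℂ stdThree = 3 := by
  let e : stdThree ≃ₗ[ℂ] (Fin 3 → ℂ) :=
    { toFun := fun z ↦ ![z.1 0, z.1 1, z.1 2]
      invFun := fun a ↦ ⟨!₂[a 0, a 1, a 2, 0, 0], by simp [mem_stdThree]⟩
      map_add' := fun z w ↦ by ext i; fin_cases i <;> simp
      map_smul' := fun a z ↦ by ext i; fin_cases i <;> simp
      left_inv := fun ⟨z, h₃, h₄⟩ ↦ by ext i; fin_cases i <;> simp [h₃, h₄]
      right_inv := fun a ↦ by ext i; fin_cases i <;> simp }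
  simp [e.finrank_eq]

lemma stdTwo_isOrtho_stdThree : stdTwo ⟂ stdThree := by
  rw [Submodule.isOrtho_iff_inner_eq]
  rintro z ⟨h₀, h₁, h₂⟩ w ⟨h₃, h₄⟩
  simp [PiLp.inner_apply, Fin.sum_univ_five, h₀, h₁, h₂, h₃, h₄]

lemma isCompl_stdTwo_stdThree : IsCompl stdTwo stdThree := by
  refine ⟨stdTwo_isOrtho_stdThree.disjoint, codisjoint_iff.mpr (eq_top_iff.mpr fun z _ ↦ ?_)⟩
  refine Submodule.mem_sup.mpr ⟨!₂[0, 0, 0, z 3, z 4], by simp [mem_stdTwo],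
    !₂[z 0, z 1, z 2, 0, 0], by simp [mem_stdThree], ?_⟩
  ext i
  fin_cases i <;> simp

lemma toEuclideanLin_blockDiag_castAdd (g : Matrix (Fin 3) (Fin 3) ℂ) (h : Matrix (Fin 2) (Fin 2) ℂ)
    (z : CSpace 5) (i : Fin 3) :
    Matrix.toEuclideanLin (blockDiag g h) z (Fin.castAdd 2 i) =
      ∑ j, g i j * z (Fin.castAdd 2 j) := by
  change ∑ j : Fin (3 + 2), Matrix.fromBlocks g 0 0 h (finSumFinEquiv.symm (Fin.castAdd 2 i))
    (finSumFinEquiv.symm j) * z j = _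
  rw [Fin.sum_univ_add]
  simp only [finSumFinEquiv_symm_apply_castAdd, finSumFinEquiv_symm_apply_natAdd,
    Matrix.fromBlocks_apply₁₁, Matrix.fromBlocks_apply₁₂, Matrix.zero_apply, zero_mul,
    Finset.sum_const_zero, add_zero]

lemma toEuclideanLin_blockDiag_natAdd (g : Matrix (Fin 3) (Fin 3) ℂ) (h : Matrix (Fin 2) (Fin 2) ℂ)
    (z : CSpace 5) (i : Fin 2) :
    Matrix.toEuclideanLin (blockDiag g h) z (Fin.natAdd 3 i) =
      ∑ j, h i j * z (Fin.natAdd 3 j) := by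
  change ∑ j : Fin (3 + 2), Matrix.fromBlocks g 0 0 h (finSumFinEquiv.symm (Fin.natAdd 3 i))
    (finSumFinEquiv.symm j) * z j = _
  rw [Fin.sum_univ_add]
  simp only [finSumFinEquiv_symm_apply_castAdd, finSumFinEquiv_symm_apply_natAdd,
    Matrix.fromBlocks_apply₂₁, Matrix.fromBlocks_apply₂₂, Matrix.zero_apply, zero_mul,
    Finset.sum_const_zero, zero_add]

lemma mem_stdTwo_iff_castAdd {z : CSpace 5} : z ∈ stdTwo ↔ ∀ i : Fin 3, z (Fin.castAdd 2 i) = 0 := by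
  rw [mem_stdTwo, Fin.forall_fin_succ, Fin.forall_fin_two]
  rfl

lemma mem_stdThree_iff_natAdd {z : CSpace 5} :
    z ∈ stdThree ↔ ∀ i : Fin 2, z (Fin.natAdd 3 i) = 0 := by
  rw [mem_stdThree, Fin.forall_fin_two]
  rfl

lemma blockDiag_injective {g g' : Matrix (Fin 3) (Fin 3) ℂ} {h h' : Matrix (Fin 2) (Fin 2) ℂ}
    (H : blockDiag g h = blockDiag g' h') : g = g' ∧ h = h' := by
  have H' := congrArg (fun A ↦ A.submatrix (finSumFinEquiv (m := 3) (n := 2))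
    (finSumFinEquiv (m := 3) (n := 2))) H
  simp only [blockDiag, Matrix.submatrix_submatrix, Equiv.symm_comp_self, Matrix.submatrix_id_id]
    at H'
  have := Matrix.fromBlocks_inj.mp H'
  exact ⟨this.1, this.2.2.2⟩

lemma mem_SU3U2_iff (A : Matrix.specialUnitaryGroup (Fin 5) ℂ) :
    A ∈ SU3U2 ↔ (∀ z ∈ stdTwo, Matrix.toEuclideanLin A.1 z ∈ stdTwo) ∧
      (∀ z ∈ stdThree, Matrix.toEuclideanLin A.1 z ∈ stdThree) := by
  constructor
  · rintro ⟨g, -, h, -, hA⟩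
    rw [hA]
    refine ⟨fun z hz ↦ ?_, fun z hz ↦ ?_⟩
    · rw [mem_stdTwo_iff_castAdd] at hz ⊢
      intro i
      rw [toEuclideanLin_blockDiag_castAdd]
      exact Finset.sum_eq_zero fun j _ ↦ by rw [hz j, mul_zero]
    · rw [mem_stdThree_iff_natAdd] at hz ⊢
      intro i
      rw [toEuclideanLin_blockDiag_natAdd]
      exact Finset.sum_eq_zero fun j _ ↦ by rw [hz j, mul_zero]
  · rintro ⟨h₂, h₃⟩
    -- The off-diagonal blocks vanish: apply `A` to the standard basis vectors.
    have h₁₂ (i : Fin 3) (j : Fin 2) : A.1 (Fin.castAdd 2 i) (Fin.natAdd 3 j) = 0 := by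
      have hj : EuclideanSpace.single (Fin.natAdd 3 j) (1 : ℂ) ∈ stdTwo := by
        rw [mem_stdTwo_iff_castAdd]
        intro i
        rw [PiLp.single_apply, if_neg]
        exact Fin.ne_of_lt (by simp [Fin.lt_def]; omega)
      simpa using mem_stdTwo_iff_castAdd.mp (h₂ _ hj) i
    have h₂₁ (i : Fin 2) (j : Fin 3) : A.1 (Fin.natAdd 3 i) (Fin.castAdd 2 j) = 0 := by
      have hj : EuclideanSpace.single (Fin.castAdd 2 j) (1 : ℂ) ∈ stdThree := by
        rw [mem_stdThree_iff_natAdd]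
        intro i
        rw [PiLp.single_apply, if_neg]
        exact Fin.ne_of_gt (by simp [Fin.lt_def]; omega)
      simpa using mem_stdThree_iff_natAdd.mp (h₃ _ hj) i
    let B := A.1.submatrix (finSumFinEquiv (m := 3) (n := 2)) (finSumFinEquiv (m := 3) (n := 2))
    have hB : B = Matrix.fromBlocks B.toBlocks₁₁ 0 0 B.toBlocks₂₂ := by
      conv_lhs => rw [← Matrix.fromBlocks_toBlocks B]
      refine Matrix.fromBlocks_inj.mpr ⟨rfl, ?_, ?_, rfl⟩
      · ext i j
        exact h₁₂ i j
      · ext i j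
        exact h₂₁ i j
    have hA : A.1 = blockDiag B.toBlocks₁₁ B.toBlocks₂₂ := by
      rw [blockDiag, ← hB]
      simp [B]
    have hU : star A.1 * A.1 = 1 :=
      Matrix.mem_unitaryGroup_iff'.mp (Matrix.mem_specialUnitaryGroup_iff.mp A.2).1
    rw [hA, star_blockDiag, blockDiag_mul, ← blockDiag_one] at hU
    obtain ⟨hg, hh⟩ := blockDiag_injective hU
    exact ⟨_, Matrix.mem_unitaryGroup_iff'.mpr hg, _, Matrix.mem_unitaryGroup_iff'.mpr hh, hA⟩

/-- The unitary group acts transitively on the subspaces of a given dimension. -/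
lemma exists_linearIsometryEquiv_mem_iff_of_finrank_eq {𝕜 E : Type*} [RCLike 𝕜]
    [NormedAddCommGroup E] [InnerProductSpace 𝕜 E] [FiniteDimensional 𝕜 E] {S T : Submodule 𝕜 E}
    (h : Module.finrank 𝕜 S = Module.finrank 𝕜 T) :
    ∃ U : E ≃ₗᵢ[𝕜] E, ∀ z, U z ∈ T ↔ z ∈ S := by
  let e : S ≃ₗᵢ[𝕜] T := (stdOrthonormalBasis 𝕜 S).equiv (stdOrthonormalBasis 𝕜 T) (finCongr h)
  let L : S →ₗᵢ[𝕜] E := T.subtypeₗᵢ.comp e.toLinearIsometry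
  let U : E ≃ₗᵢ[𝕜] E := L.extend.toLinearIsometryEquiv rfl
  have hU (s : S) : U s = e s := L.extend_apply s
  refine ⟨U, fun z ↦ ⟨fun hz ↦ ?_, fun hz ↦ ?_⟩⟩
  · have hz' : U (e.symm ⟨U z, hz⟩ : S) = U z := by rw [hU, e.apply_symm_apply]
    rw [← U.injective hz']
    exact (e.symm ⟨U z, hz⟩).2
  · rw [hU ⟨z, hz⟩]
    exact (e ⟨z, hz⟩).2

lemma LinearIsometryEquiv.map_mem_orthogonal_iff {𝕜 E : Type*} [RCLike 𝕜]
    [NormedAddCommGroup E] [InnerProductSpace 𝕜 E] {S T : Submodule 𝕜 E}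
    (U : E ≃ₗᵢ[𝕜] E) (hU : ∀ z, U z ∈ T ↔ z ∈ S) (z : E) : U z ∈ Tᗮ ↔ z ∈ Sᗮ := by
  simp only [Submodule.mem_orthogonal]
  rw [U.surjective.forall]
  simp only [hU, LinearIsometryEquiv.inner_map_map]

lemma eq_orthogonal_of_isOrtho_of_isCompl {𝕜 E : Type*} [RCLike 𝕜]
    [NormedAddCommGroup E] [InnerProductSpace 𝕜 E] {S T : Submodule 𝕜 E}
    (h : S ⟂ T) (hc : IsCompl S T) : T = Sᗮ := by
  refine eq_of_le_of_inf_le_of_le_sup (z := S) h.symm ?_ ?_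
  · rw [inf_comm, S.inf_orthogonal_eq_bot]
    exact bot_le
  · rw [sup_comm, hc.sup_eq_top]
    exact le_top

/-- `SU(m)` is stable under conjugation by unitary maps. -/
lemma exists_specialUnitaryGroup_conj {m : ℕ} (A : Matrix.specialUnitaryGroup (Fin m) ℂ)
    (U : CSpace m ≃ₗᵢ[ℂ] CSpace m) :
    ∃ B : Matrix.specialUnitaryGroup (Fin m) ℂ,
      ∀ z, U (Matrix.toEuclideanLin B.1 z) = Matrix.toEuclideanLin A.1 (U z) := by
  let b := EuclideanSpace.basisFun (Fin m) ℂ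
  let C : Matrix (Fin m) (Fin m) ℂ := b.toBasis.toMatrix (b.map U)
  have hC : C ∈ Matrix.unitaryGroup (Fin m) ℂ := b.toMatrix_orthonormalBasis_mem_unitary (b.map U)
  have hCC : C * star C = 1 := Matrix.mem_unitaryGroup_iff.mp hC
  have hU (z : CSpace m) : Matrix.toEuclideanLin C z = U z := by
    suffices Matrix.toEuclideanLin C = U.toLinearEquiv.toLinearMap from LinearMap.congr_fun this z
    refine b.toBasis.ext fun j ↦ ?_
    ext i
    simp [C, b, Module.Basis.toMatrix_apply]
  have hA := Matrix.mem_specialUnitaryGroup_iff.mp A.2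
  refine ⟨⟨star C * A.1 * C, Matrix.mem_specialUnitaryGroup_iff.mpr
    ⟨mul_mem (mul_mem (Unitary.star_mem hC) hA.1) hC, ?_⟩⟩, fun z ↦ ?_⟩
  · rw [Matrix.det_mul, Matrix.det_mul, hA.2, mul_one, ← Matrix.det_mul,
      Matrix.mem_unitaryGroup_iff'.mp hC, Matrix.det_one]
  · rw [← hU, ← hU]
    simp only [Matrix.toLpLin_apply, Matrix.mulVec_mulVec, ← mul_assoc, hCC, one_mul]

/-! ### Complex structures and subspaces in a frame -/

lemma suToOrthogonal_realCoords {m : ℕ} (A : Matrix.specialUnitaryGroup (Fin m) ℂ) (z : CSpace m) :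
    suToOrthogonal m A (realCoords m z) = realCoords m (Matrix.toEuclideanLin A.1 z) := by
  change realCoords m (Matrix.toEuclideanLin A.1 ((realCoords m).symm (realCoords m z))) = _
  rw [LinearIsometryEquiv.symm_apply_apply]

lemma real_inner_eq_re_inner_cspace {m : ℕ} (z w : CSpace m) :
    inner ℝ z w = (inner ℂ z w).re := by
  simp [PiLp.inner_apply, Complex.inner]

/-- The imaginary part of the Hermitian inner product is the real inner product with `i • z`. -/
lemma inner_eq_zero_of_real_inner_eq_zero {m : ℕ} {z w : CSpace m} (h : inner ℝ z w = 0)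
    (hI : inner ℝ (Complex.I • z) w = 0) : inner ℂ z w = 0 := by
  rw [real_inner_eq_re_inner_cspace] at h hI
  rw [inner_smul_left] at hI
  exact Complex.ext h (by simpa using hI)

lemma smul_mem_of_I_smul_mem {F : Type*} [AddCommGroup F] [Module ℂ F] (S : Submodule ℝ F)
    (hS : ∀ z ∈ S, Complex.I • z ∈ S) (a : ℂ) {z : F} (hz : z ∈ S) : a • z ∈ S := by
  have h : a • z = a.re • z + a.im • (Complex.I • z) := by
    conv_lhs => rw [← Complex.re_add_im a]
    rw [add_smul, mul_smul, Complex.coe_smul, Complex.coe_smul]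
  rw [h]
  exact S.add_mem (S.smul_mem _ hz) (S.smul_mem _ (hS z hz))

section Frame

variable {m : ℕ} {E : Type*} [NormedAddCommGroup E] [InnerProductSpace ℝ E]

/-- Multiplication by `i` on `ℂᵐ`, carried to `E` by the frame `ψ : ℂᵐ → E`. -/
noncomputable def frameComplexStructure (ψ : CSpace m ≃ₗᵢ[ℝ] E) : E →ₗ[ℝ] E :=
  ψ.toLinearEquiv.conj ((Complex.I • (LinearMap.id : CSpace m →ₗ[ℂ] CSpace m)).restrictScalars ℝ)

lemma frameComplexStructure_apply (ψ : CSpace m ≃ₗᵢ[ℝ] E) (z : CSpace m) :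
    frameComplexStructure ψ (ψ z) = ψ (Complex.I • z) := by
  change ψ (Complex.I • ψ.symm (ψ z)) = _
  rw [ψ.symm_apply_apply]

/-- The real subspace of `E` of the vectors whose coordinates with respect to the frame
`ψ : ℂᵐ → E` lie in `S`. -/
noncomputable def frameSubspace (ψ : CSpace m ≃ₗᵢ[ℝ] E) (S : Submodule ℂ (CSpace m)) :
    Submodule ℝ E :=
  (S.restrictScalars ℝ).map (ψ.toLinearEquiv : CSpace m →ₗ[ℝ] E)

lemma map_mem_frameSubspace {ψ : CSpace m ≃ₗᵢ[ℝ] E} {S : Submodule ℂ (CSpace m)} {z : CSpace m} :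
    ψ z ∈ frameSubspace ψ S ↔ z ∈ S :=
  ψ.injective.mem_set_image (s := S)

lemma finrank_frameSubspace (ψ : CSpace m ≃ₗᵢ[ℝ] E) (S : Submodule ℂ (CSpace m)) :
    Module.finrank ℝ (frameSubspace ψ S) = 2 * Module.finrank ℂ S :=
  (LinearEquiv.finrank_map_eq ψ.toLinearEquiv (S.restrictScalars ℝ)).trans
    (finrank_real_of_complex S)

lemma inner_eq_zero_of_mem_frameSubspace (ψ : CSpace m ≃ₗᵢ[ℝ] E) {S T : Submodule ℂ (CSpace m)}
    (h : S ⟂ T) : ∀ v ∈ frameSubspace ψ S, ∀ w ∈ frameSubspace ψ T, inner ℝ v w = 0 := by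
  rintro _ ⟨z, hz, rfl⟩ _ ⟨w, hw, rfl⟩
  refine (ψ.inner_map_map z w).trans ?_
  rw [real_inner_eq_re_inner_cspace, (Submodule.isOrtho_iff_inner_eq.mp h) z hz w hw,
    Complex.zero_re]

lemma isCompl_frameSubspace (ψ : CSpace m ≃ₗᵢ[ℝ] E) {S T : Submodule ℂ (CSpace m)}
    (h : IsCompl S T) : IsCompl (frameSubspace ψ S) (frameSubspace ψ T) := by
  constructor
  · rw [Submodule.disjoint_def]
    rintro _ ⟨z, hz, rfl⟩ hT
    have : z = 0 := Submodule.disjoint_def.mp h.disjoint z hz (map_mem_frameSubspace.mp hT)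
    rw [this, map_zero]
  · refine codisjoint_iff.mpr (eq_top_iff.mpr fun v _ ↦ ?_)
    obtain ⟨z, rfl⟩ := ψ.surjective v
    obtain ⟨s, hs, t, ht, rfl⟩ := Submodule.mem_sup.mp
      (show z ∈ S ⊔ T by rw [h.sup_eq_top]; trivial)
    rw [map_add]
    exact Submodule.add_mem_sup (map_mem_frameSubspace.mpr hs) (map_mem_frameSubspace.mpr ht)

/-- A real subspace that is stable under the complex structure induced by the frame is a complex
subspace in coordinates. -/
lemma exists_frameSubspace_eq (ψ : CSpace m ≃ₗᵢ[ℝ] E) {V : Submodule ℝ E}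
    (hV : ∀ z, ψ z ∈ V → ψ (Complex.I • z) ∈ V) : ∃ S, frameSubspace ψ S = V := by
  let V' : Submodule ℝ (CSpace m) := V.comap (ψ.toLinearEquiv : CSpace m →ₗ[ℝ] E)
  refine ⟨{ V' with smul_mem' := fun a z hz ↦ smul_mem_of_I_smul_mem V' hV a hz }, ?_⟩
  ext v
  obtain ⟨z, rfl⟩ := ψ.surjective v
  exact map_mem_frameSubspace

/-- A splitting of `E` into orthogonal complex subspaces is the standard splitting `ℂ² ⊕ ℂ³` after
a unitary change of the frame. -/
lemma exists_adapted_frame (ψ : CSpace 5 ≃ₗᵢ[ℝ] E) {V W : Submodule ℝ E}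
    (hV : Module.finrank ℝ V = 4) (hVW : IsCompl V W) (hort : ∀ v ∈ V, ∀ w ∈ W, inner ℝ v w = 0)
    (hJV : ∀ z, ψ z ∈ V → ψ (Complex.I • z) ∈ V) (hJW : ∀ z, ψ z ∈ W → ψ (Complex.I • z) ∈ W) :
    ∃ U : CSpace 5 ≃ₗᵢ[ℂ] CSpace 5,
      (∀ z, ψ (U z) ∈ V ↔ z ∈ stdTwo) ∧ (∀ z, ψ (U z) ∈ W ↔ z ∈ stdThree) := by
  obtain ⟨S, rfl⟩ := exists_frameSubspace_eq ψ hJV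
  obtain ⟨T, rfl⟩ := exists_frameSubspace_eq ψ hJW
  have hS : Module.finrank ℂ stdTwo = Module.finrank ℂ S := by
    rw [finrank_frameSubspace] at hV
    rw [finrank_stdTwo]
    omega
  have hST : S ⟂ T := by
    rw [Submodule.isOrtho_iff_inner_eq]
    intro z hz w hw
    have h {z : CSpace 5} (hz : z ∈ S) : inner ℝ z w = 0 := by
      rw [← ψ.inner_map_map]
      exact hort _ (map_mem_frameSubspace.mpr hz) _ (map_mem_frameSubspace.mpr hw)
    exact inner_eq_zero_of_real_inner_eq_zero (h hz) (h (S.smul_mem Complex.I hz))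
  have hT : T = Sᗮ := by
    refine eq_orthogonal_of_isOrtho_of_isCompl hST ⟨hST.disjoint, codisjoint_iff.mpr ?_⟩
    refine eq_top_iff.mpr fun z _ ↦ ?_
    obtain ⟨_, ⟨s, hs, rfl⟩, _, ⟨t, ht, rfl⟩, h⟩ := Submodule.mem_sup.mp
      (show ψ z ∈ frameSubspace ψ S ⊔ frameSubspace ψ T by rw [hVW.sup_eq_top]; trivial)
    rw [← ψ.injective ((map_add ψ s t).trans h)]
    exact Submodule.add_mem_sup hs ht
  obtain ⟨U, hU⟩ := exists_linearIsometryEquiv_mem_iff_of_finrank_eq hS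
  refine ⟨U, fun z ↦ map_mem_frameSubspace.trans (hU z), fun z ↦ map_mem_frameSubspace.trans ?_⟩
  rw [hT, eq_orthogonal_of_isOrtho_of_isCompl stdTwo_isOrtho_stdThree isCompl_stdTwo_stdThree]
  exact U.map_mem_orthogonal_iff hU z

end Frame

/-! ### Calabi–Yau structures with a parallel splitting -/

section CalabiYau

variable {M : Type*} [TopologicalSpace M] [ChartedSpace (RSpace 10) M] [IsManifold (𝓡 10) ∞ M]
  [RiemannianBundle (fun x : M ↦ TangentSpace (𝓡 10) x)]

/-- If all parallel transports lie in `𝒢` with respect to frames `ℂ⁵ → T_x M`, then the frames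
transport the complex structure and the splitting of `ℂ⁵` to the manifold. -/
lemma calabiYau_splitting_of_frames (ψ : ∀ x : M, CSpace 5 ≃ₗᵢ[ℝ] TangentSpace (𝓡 10) x)
    (hψ : ∀ (x y : M) (P : TangentSpace (𝓡 10) x ≃ₗ[ℝ] TangentSpace (𝓡 10) y),
      IsParallelTransport P → ∃ A ∈ SU3U2, ∀ z, P (ψ x z) = ψ y (Matrix.toEuclideanLin A.1 z)) :
    IsCalabiYauStructure (fun x ↦ frameComplexStructure (ψ x)) ∧
      IsParallelSplitting (fun x ↦ frameComplexStructure (ψ x))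
        (fun x ↦ frameSubspace (ψ x) stdTwo) (fun x ↦ frameSubspace (ψ x) stdThree) := by
  refine ⟨⟨⟨fun x v ↦ ?_, fun x v w ↦ ?_, fun x y P hP v ↦ ?_⟩, fun x ↦ ?_⟩, ?_⟩
  · obtain ⟨z, rfl⟩ := (ψ x).surjective v
    rw [frameComplexStructure_apply, frameComplexStructure_apply, smul_smul, Complex.I_mul_I,
      neg_one_smul, map_neg]
  · obtain ⟨z, rfl⟩ := (ψ x).surjective v
    obtain ⟨z', rfl⟩ := (ψ x).surjective w
    rw [frameComplexStructure_apply, frameComplexStructure_apply,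
      LinearIsometryEquiv.inner_map_map, LinearIsometryEquiv.inner_map_map,
      real_inner_eq_re_inner_cspace, real_inner_eq_re_inner_cspace, inner_smul_left,
      inner_smul_right]
    simp
  · obtain ⟨z, rfl⟩ := (ψ x).surjective v
    obtain ⟨A, -, hA⟩ := hψ x y P hP
    rw [frameComplexStructure_apply, hA, hA, frameComplexStructure_apply, map_smul]
  · refine ⟨(realCoords 5).symm.trans (ψ x), fun z ↦ ?_, fun P hP ↦ ?_⟩
    · simp only [LinearIsometryEquiv.trans_apply, LinearIsometryEquiv.symm_apply_apply]
      exact (frameComplexStructure_apply _ _).symm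
    · obtain ⟨A, -, hA⟩ := hψ x x P hP
      refine ⟨suToOrthogonal 5 A, ⟨A, rfl⟩, fun v ↦ ?_⟩
      obtain ⟨z, rfl⟩ := (realCoords 5).surjective v
      rw [suToOrthogonal_realCoords]
      simp only [LinearIsometryEquiv.trans_apply, LinearIsometryEquiv.symm_apply_apply]
      exact hA z
  · refine ⟨fun x ↦ ?_, fun x ↦ ?_, fun x ↦ isCompl_frameSubspace _ isCompl_stdTwo_stdThree,
      fun x ↦ inner_eq_zero_of_mem_frameSubspace _ stdTwo_isOrtho_stdThree, ?_, ?_, ?_, ?_⟩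
    · rw [finrank_frameSubspace, finrank_stdTwo]
    · rw [finrank_frameSubspace, finrank_stdThree]
    · rintro x _ ⟨z, hz, rfl⟩
      exact ⟨_, stdTwo.smul_mem Complex.I hz, (frameComplexStructure_apply _ _).symm⟩
    · rintro x _ ⟨z, hz, rfl⟩
      exact ⟨_, stdThree.smul_mem Complex.I hz, (frameComplexStructure_apply _ _).symm⟩
    · rintro x y P hP _ ⟨z, hz, rfl⟩
      obtain ⟨A, hG, hA⟩ := hψ x y P hP
      exact ⟨_, ((mem_SU3U2_iff A).mp hG).1 z hz, (hA z).symm⟩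
    · rintro x y P hP _ ⟨z, hz, rfl⟩
      obtain ⟨A, hG, hA⟩ := hψ x y P hP
      exact ⟨_, ((mem_SU3U2_iff A).mp hG).2 z hz, (hA z).symm⟩

/-- A unitary change of the frame that adapts it to the splitting keeps the holonomy in `SU(5)`;
being compatible with the splitting, it then lies in `𝒢`. -/
lemma IsParallelSplitting.isGManifold
    {J : ∀ x : M, TangentSpace (𝓡 10) x →ₗ[ℝ] TangentSpace (𝓡 10) x}
    {V W : ∀ x : M, Submodule ℝ (TangentSpace (𝓡 10) x)} (hVW : IsParallelSplitting J V W)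
    (hJ : IsCalabiYauStructure J) : IsGManifold M smGroup := by
  intro x
  obtain ⟨φ, hI, hφ⟩ := hJ.holonomy_le x
  let ψ : CSpace 5 ≃ₗᵢ[ℝ] TangentSpace (𝓡 10) x := (realCoords 5).trans φ
  have hψI (z : CSpace 5) : ψ (Complex.I • z) = J x (ψ z) := hI z
  obtain ⟨U, hU₂, hU₃⟩ := exists_adapted_frame ψ (hVW.finrank_four x) (hVW.isCompl x)
    (hVW.orthogonal x) (fun z hz ↦ by rw [hψI]; exact hVW.complex_four x _ hz)
    (fun z hz ↦ by rw [hψI]; exact hVW.complex_six x _ hz)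
  let Uℝ : CSpace 5 ≃ₗᵢ[ℝ] CSpace 5 := ⟨U.toLinearEquiv.restrictScalars ℝ, U.norm_map⟩
  refine ⟨((realCoords 5).symm.trans Uℝ).trans ψ, fun P hP ↦ ?_⟩
  obtain ⟨_, ⟨A, rfl⟩, hA⟩ := hφ P hP
  obtain ⟨B, hB⟩ := exists_specialUnitaryGroup_conj A U
  have hPB (z : CSpace 5) : P (ψ (U z)) = ψ (U (Matrix.toEuclideanLin B.1 z)) := by
    refine (hA (realCoords 5 (U z))).trans ?_
    rw [suToOrthogonal_realCoords, hB]
    rfl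
  have hBG : B ∈ SU3U2 := by
    rw [mem_SU3U2_iff]
    refine ⟨fun z hz ↦ ?_, fun z hz ↦ ?_⟩
    · rw [← hU₂, ← hPB]
      exact hVW.parallel_four x x P hP _ ((hU₂ z).mpr hz)
    · rw [← hU₃, ← hPB]
      exact hVW.parallel_six x x P hP _ ((hU₃ z).mpr hz)
  refine ⟨suToOrthogonal 5 B, ⟨B, hBG, rfl⟩, fun v ↦ ?_⟩
  obtain ⟨z, rfl⟩ := (realCoords 5).surjective v
  rw [suToOrthogonal_realCoords]
  simp only [LinearIsometryEquiv.trans_apply, LinearIsometryEquiv.symm_apply_apply]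
  exact hPB z

end CalabiYau

theorem mainTheorem1 {M : Type*} [TopologicalSpace M] [ChartedSpace (RSpace 10) M]
    [IsManifold (𝓡 10) ∞ M] [RiemannianBundle (fun x : M ↦ TangentSpace (𝓡 10) x)]
    [IsContMDiffRiemannianBundle (𝓡 10) ∞ (RSpace 10) (fun x : M ↦ TangentSpace (𝓡 10) x)] :
    (IsGManifold M smGroup ↔
      ∃ (J : ∀ x : M, TangentSpace (𝓡 10) x →ₗ[ℝ] TangentSpace (𝓡 10) x)
        (V W : ∀ x : M, Submodule ℝ (TangentSpace (𝓡 10) x)),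
        IsCalabiYauStructure J ∧ IsParallelSplitting J V W) ∧
    (Module.finrank ℂ stdTwo = 2 ∧ Module.finrank ℂ stdThree = 3 ∧ stdTwo ⟂ stdThree ∧
      IsCompl stdTwo stdThree ∧
      ∀ A : Matrix.specialUnitaryGroup (Fin 5) ℂ, A ∈ SU3U2 ↔
        (∀ z ∈ stdTwo, Matrix.toEuclideanLin A.1 z ∈ stdTwo) ∧
        (∀ z ∈ stdThree, Matrix.toEuclideanLin A.1 z ∈ stdThree)) := by
  refine ⟨⟨fun hG ↦ ?_, fun ⟨J, V, W, hJ, hVW⟩ ↦ hVW.isGManifold hJ⟩, finrank_stdTwo,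
    finrank_stdThree, stdTwo_isOrtho_stdThree, isCompl_stdTwo_stdThree, mem_SU3U2_iff⟩
  obtain ⟨φ, hφ⟩ := hG.exists_frames
  refine ⟨_, _, _, calabiYau_splitting_of_frames (fun x ↦ (realCoords 5).trans (φ x))
    fun x y P hP ↦ ?_⟩
  obtain ⟨_, ⟨A, hA, rfl⟩, h⟩ := hφ x y P hP
  refine ⟨A, hA, fun z ↦ (h (realCoords 5 z)).trans ?_⟩
  rw [suToOrthogonal_realCoords]
  rfl
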